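/- Let $k,\ell\ge 1$ be integers and let $\lambda=(\lambda_1\ge\lambda_2\ge\cdots)$ be a partition in the hook $H(k,\ell)$, i.e. $\lambda_{k+1}\le \ell$. Order the letters as $t_1<\dots<t_k<u_1<\dots<u_\ell$. A $(k,\ell)$-semistandard tableau of shape $\lambda$ is a filling $T$ of the Young diagram of $\lambda$ with these letters whose entries are weakly increasing along rows and down columns, such that the $t$-letters are strictly increasing down columns and the $u$-letters are strictly increasing along rows. Let $a_i(T)$ and $b_j(T)$ be the numbers of occurrences of $t_i$ and $u_j$ in $T$, and let \[ S_\lambda(x,y)=\sum_{T} x_1^{a_1(T)}\cdots x_k^{a_k(T)}\,y_1^{b_1(T)}\cdots y_\ell^{b_\ell(T)}\in\mathbb Z[x_1,\dots,x_k,y_1,\dots,y_\ell], \] the sum being over all $(k,\ell)$-semistandard tableaux $T$ of shape $\lambda$, be the supersymmetric Schur polynomial. Then $S_\lambda$ has a saturated Newton polytope: if $\operatorname{Supp}(S_\lambda)\subset\mathbb Z^{k+\ell}$ is the set of exponent vectors of the monomials with non-zero coefficient in $S_\lambda$ and $\operatorname{Newton}(S_\lambda)\subset\mathbb R^{k+\ell}$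 is the convex hull of $\operatorname{Supp}(S_\lambda)$, then \[ \operatorname{Newton}(S_\lambda)\cap\mathbb Z^{k+\ell}=\operatorname{Supp}(S_\lambda). \] -/

import Mathlib

/-- The partition `μ` lies in the hook `H(k, ℓ)`: its part number `k + 1` is at most `ℓ`.
Partitions are Young diagrams, whose rows are numbered from `0`. -/
def InHook (k ℓ : ℕ) (μ : YoungDiagram) : Prop :=
  μ.rowLen k ≤ ℓ

/-- `T` is a `(k, ℓ)`-semistandard tableau of shape `μ`. The letter `t_i` is `Sum.inl i`, the letter
`u_j` is `Sum.inr j`, and the alphabet carries the total order `t_1 < ⋯ < t_k < u_1 < ⋯ < u_ℓ`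
(the lexicographic order on the sum). A cell is a pair `(row, column)`. -/
structure IsSuperSemistandard {k ℓ : ℕ} {μ : YoungDiagram}
    (T : {c // c ∈ μ.cells} → Fin k ⊕ Fin ℓ) : Prop where
  /-- entries are weakly increasing along rows -/
  row_weak : ∀ c d : {c // c ∈ μ.cells}, c.1.1 = d.1.1 → c.1.2 < d.1.2 →
    toLex (T c) ≤ toLex (T d)
  /-- entries are weakly increasing down columns -/
  col_weak : ∀ c d : {c // c ∈ μ.cells}, c.1.2 = d.1.2 → c.1.1 < d.1.1 →
    toLex (T c) ≤ toLex (T d)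
  /-- the `t`-letters are strictly increasing down columns -/
  t_col_strict : ∀ c d : {c // c ∈ μ.cells}, c.1.2 = d.1.2 → c.1.1 < d.1.1 →
    ∀ i i' : Fin k, T c = Sum.inl i → T d = Sum.inl i' → i < i'
  /-- the `u`-letters are strictly increasing along rows -/
  u_row_strict : ∀ c d : {c // c ∈ μ.cells}, c.1.1 = d.1.1 → c.1.2 < d.1.2 →
    ∀ j j' : Fin ℓ, T c = Sum.inr j → T d = Sum.inr j' → j < j'

/-- The number of occurrences of the letter `s` in the filling `T`. -/
def letterCount {k ℓ : ℕ} {μ : YoungDiagram} (T : {c // c ∈ μ.cells} → Fin k ⊕ Fin ℓ)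
    (s : Fin k ⊕ Fin ℓ) : ℕ :=
  (Finset.univ.filter fun c => T c = s).card

open Classical in
/-- The finite set of `(k, ℓ)`-semistandard tableaux of shape `μ`. -/
noncomputable def superSSYT (k ℓ : ℕ) (μ : YoungDiagram) :
    Finset ({c // c ∈ μ.cells} → Fin k ⊕ Fin ℓ) :=
  Finset.univ.filter fun T => IsSuperSemistandard T

/-- The supersymmetric Schur polynomial `S_μ(x, y)`; the variable `x_i` is `X (Sum.inl i)` and
`y_j` is `X (Sum.inr j)`. -/
noncomputable def superSchur (k ℓ : ℕ) (μ : YoungDiagram) : MvPolynomial (Fin k ⊕ Fin ℓ) ℤ :=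
  ∑ T ∈ superSSYT k ℓ μ,
    (∏ i : Fin k, MvPolynomial.X (Sum.inl i) ^ letterCount T (Sum.inl i)) *
      ∏ j : Fin ℓ, MvPolynomial.X (Sum.inr j) ^ letterCount T (Sum.inr j)

/-- The support of `f`, as a set of points of `ℝ^σ`. -/
def realSupport {σ R : Type*} [CommSemiring R] (f : MvPolynomial σ R) : Set (σ → ℝ) :=
  {p | ∃ α : σ →₀ ℕ, MvPolynomial.coeff α f ≠ 0 ∧ p = fun i => (α i : ℝ)}

/-- The Newton polytope of `f`. -/
def newtonPolytope {σ R : Type*} [CommSemiring R] (f : MvPolynomial σ R) : Set (σ → ℝ) :=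
  convexHull ℝ (realSupport f)

/-- The lattice `ℤ^σ` inside `ℝ^σ`. -/
def latticePoints (σ : Type*) : Set (σ → ℝ) :=
  Set.range fun (z : σ → ℤ) (i : σ) => (z i : ℝ)

/-- `f` has a saturated Newton polytope. -/
def HasSaturatedNewtonPolytope {σ R : Type*} [CommSemiring R] (f : MvPolynomial σ R) : Prop :=
  newtonPolytope f ∩ latticePoints σ = realSupport f

/-!
The support of `S_μ` is the set of lattice points of a polytope, the one cut out by the inequalities
that bound the total multiplicity of any `i` letters `t` and `j` letters `u` by the number of cells
of `μ` in its first `i` rows or first `j` columns. These are necessary because letters `t` can be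
pushed up their columns and letters `u` to the left along their rows.

Conversely, let a lattice point satisfy the inequalities, and permute its first `k` coordinates so
that `α_1 ≥ α_2 ≥ ⋯`. Hall's theorem distributes the letters over the rows of `μ`, with at most one
`u_j` in each row and `t_i` only in the first `i` rows. Sorting the partial row counts obtained by
adding `u_1, …, u_ℓ` one after the other to the letters `t` gives a chain of Young diagrams that
grows by vertical strips and ends at `μ`. Its first diagram satisfies the inequalities for the
letters `t`, so the same argument applied to its transpose, where the letters `t` play the role of
the letters `u` and may come in their original order, fills it by horizontal strips.
-/

section
open Finset

theorem exists_transport {ι κ : Type*} [Fintype ι] [Fintype κ] (R : ι → κ → Prop)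
    [DecidableRel R] (a : ι → ℕ) (b : κ → ℕ)
    (h : ∀ s : Finset ι, ∑ i ∈ s, a i ≤ ∑ k with ∃ i ∈ s, R i k, b k) :
    ∃ f : ι → κ → ℕ, (∀ i k, f i k ≠ 0 → R i k) ∧ (∀ i, ∑ k, f i k = a i) ∧
      ∀ k, ∑ i, f i k ≤ b k := by
  classical
  obtain ⟨F, hF, hFR⟩ : ∃ F : (Σ i, Fin (a i)) → Σ k, Fin (b k),
      Function.Injective F ∧ ∀ x, R x.1 (F x).1 := by
    refine (Fintype.all_card_le_filter_rel_iff_exists_injective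
      fun (x : Σ i, Fin (a i)) (y : Σ k, Fin (b k)) => R x.1 y.1).1 fun A => ?_
    calc #A ≤ #((A.image Sigma.fst).sigma fun i => (univ : Finset (Fin (a i)))) :=
          card_le_card fun x hx => mem_sigma.2 ⟨mem_image_of_mem _ hx, mem_univ _⟩
      _ = ∑ i ∈ A.image Sigma.fst, a i := by simp
      _ ≤ ∑ k with ∃ i ∈ A.image Sigma.fst, R i k, b k := h _
      _ = #((univ.filter fun k => ∃ i ∈ A.image Sigma.fst, R i k).sigma
            fun k => (univ : Finset (Fin (b k)))) := by simp
      _ ≤ _ := card_le_card fun y hy => by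
          obtain ⟨i, hi, hiy⟩ := (mem_filter.1 (mem_sigma.1 hy).1).2
          obtain ⟨x, hx, rfl⟩ := mem_image.1 hi
          exact mem_filter.2 ⟨mem_univ _, x, hx, hiy⟩
  refine ⟨fun i k => #{x : Fin (a i) | (F ⟨i, x⟩).1 = k}, fun i k hik => ?_, fun i => ?_,
    fun k => ?_⟩
  · obtain ⟨x, hx⟩ := card_ne_zero.1 hik
    exact (mem_filter.1 hx).2 ▸ hFR ⟨i, x⟩
  · exact (card_eq_sum_card_fiberwise (f := fun x => (F ⟨i, x⟩).1) fun _ _ =>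
      mem_coe.2 (mem_univ _)).symm.trans (Finset.card_fin _)
  · calc ∑ i, #{x : Fin (a i) | (F ⟨i, x⟩).1 = k}
        = #(univ.sigma fun i => {x : Fin (a i) | (F ⟨i, x⟩).1 = k}) := (card_sigma _ _).symm
      _ ≤ #(({k} : Finset κ).sigma fun k => (univ : Finset (Fin (b k)))) :=
          card_le_card_of_injOn F (fun x hx => by simpa using hx) hF.injOn
      _ = b k := by simp

theorem sum_add_card_le_of_capacity {R ι κ : Type*} [Fintype R] [DecidableEq R] [DecidableEq κ]
    {cap : R → ℕ} {A : ι → Finset R} {α : ι → ℕ} {β : κ → ℕ}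
    (h : ∀ (I : Finset ι) (J : Finset κ) (Q : Finset R), (∀ i ∈ I, A i ⊆ Q) →
      ∑ i ∈ I, α i + ∑ j ∈ J, β j ≤ ∑ r ∈ Q, cap r + #J * #Qᶜ)
    (I : Finset ι) (E : Finset (κ × R)) :
    ∑ i ∈ I, α i + #E ≤ ∑ r ∈ I.biUnion A ∪ E.image Prod.snd, cap r +
      ∑ j ∈ E.image Prod.fst, (Fintype.card R - β j) := by
  set J := E.image Prod.fst
  set Q := I.biUnion A ∪ E.image Prod.snd
  have hβ : ∀ j ∈ J, β j ≤ Fintype.card R := fun j _ => by simpa using h ∅ {j} ∅ (by simp)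
  have hE : #E ≤ #J * #Q := by
    rw [← card_product]
    exact card_le_card fun e he => mem_product.2
      ⟨mem_image_of_mem _ he, mem_union_right _ (mem_image_of_mem _ he)⟩
  have hIJ := h I J Q fun i hi => (subset_biUnion_of_mem A hi).trans subset_union_left
  have hJ : ∑ j ∈ J, (Fintype.card R - β j) + ∑ j ∈ J, β j = #J * #Q + #J * #Qᶜ := by
    rw [sum_tsub_distrib _ hβ, tsub_add_cancel_of_le (sum_le_sum hβ), sum_const, smul_eq_mul,
      ← mul_add, card_add_card_compl]
  omega

-- Every pair `(j, r)` supplies one unit, which goes either to row `r`, where it counts for `x j r`,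
-- or to a sink `j` of capacity `card R - β j` that collects the rows avoided by `j`.
theorem exists_capacitated_flow {R ι κ : Type*} [Fintype R] [DecidableEq R] [Fintype ι]
    [Fintype κ] (cap : R → ℕ) (A : ι → Finset R) (α : ι → ℕ) (β : κ → ℕ)
    (h : ∀ (I : Finset ι) (J : Finset κ) (Q : Finset R), (∀ i ∈ I, A i ⊆ Q) →
      ∑ i ∈ I, α i + ∑ j ∈ J, β j ≤ ∑ r ∈ Q, cap r + #J * #Qᶜ) :
    ∃ (g : ι → R → ℕ) (x y : κ → R → ℕ), (∀ i r, g i r ≠ 0 → r ∈ A i) ∧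
      (∀ i, ∑ r, g i r = α i) ∧ (∀ j r, x j r + y j r = 1) ∧
      (∀ j, ∑ r, y j r ≤ Fintype.card R - β j) ∧ ∀ r, ∑ i, g i r + ∑ j, x j r ≤ cap r := by
  classical
  obtain ⟨f, hfR, hfa, hfb⟩ := exists_transport
    (Sum.elim (fun i => Sum.elim (· ∈ A i) fun _ => False)
      fun e : κ × R => Sum.elim (e.2 = ·) (e.1 = ·))
    (Sum.elim α fun _ => 1) (Sum.elim cap fun j => Fintype.card R - β j) (fun s => by
      obtain ⟨I, E, rfl⟩ : ∃ I E, s = disjSum I E := ⟨_, _, toLeft_disjSum_toRight.symm⟩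
      refine (le_of_eq ?_).trans
        ((sum_add_card_le_of_capacity h I E).trans (le_of_eq ?_))
      · simp [sum_disjSum]
      · exact (sum_disjSum _ _ (Sum.elim cap fun j => Fintype.card R - β j)).symm.trans
          (sum_congr (by ext (r | j) <;> simp) fun _ _ => rfl))
  have hιR : ∀ i j, f (.inl i) (.inr j) = 0 := fun i j => not_not.1 fun hf => hfR _ _ hf
  have hκR : ∀ j r r', r ≠ r' → f (.inr (j, r)) (.inl r') = 0 :=
    fun j r r' hr => not_not.1 fun hf => hr (hfR _ _ hf)
  have hκκ : ∀ j j' r, j ≠ j' → f (.inr (j, r)) (.inr j') = 0 :=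
    fun j j' r hj => not_not.1 fun hf => hj (hfR _ _ hf)
  refine ⟨fun i r => f (.inl i) (.inl r), fun j r => f (.inr (j, r)) (.inl r),
    fun j r => f (.inr (j, r)) (.inr j), fun i r => hfR _ _, fun i => ?_, fun j r => ?_,
    fun j => ?_, fun r => ?_⟩
  · simpa [Fintype.sum_sum_type, hιR] using hfa (.inl i)
  · have := hfa (.inr (j, r))
    rwa [Fintype.sum_sum_type, Fintype.sum_eq_single r fun r' hr' => hκR _ _ _ hr'.symm,
      Fintype.sum_eq_single j fun j' hj' => hκκ _ _ _ hj'.symm] at this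
  · have := hfb (.inr j)
    rwa [Fintype.sum_sum_type, Fintype.sum_eq_zero _ fun i => hιR i j, zero_add,
      Fintype.sum_prod_type, Fintype.sum_eq_single j fun j' hj' =>
        Fintype.sum_eq_zero _ fun r => hκκ _ _ _ hj'] at this
  · have := hfb (.inl r)
    rwa [Fintype.sum_sum_type, Fintype.sum_prod_type, sum_congr rfl fun j _ =>
      Fintype.sum_eq_single r fun r' hr' => hκR _ _ _ hr'] at this

theorem exists_capacitated_assignment {R ι κ : Type*} [Fintype R] [DecidableEq R] [Fintype ι]
    [Fintype κ] (cap : R → ℕ) (A : ι → Finset R) (α : ι → ℕ) (β : κ → ℕ)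
    (h : ∀ (I : Finset ι) (J : Finset κ) (Q : Finset R), (∀ i ∈ I, A i ⊆ Q) →
      ∑ i ∈ I, α i + ∑ j ∈ J, β j ≤ ∑ r ∈ Q, cap r + #J * #Qᶜ) :
    ∃ (g : ι → R → ℕ) (U : κ → Finset R), (∀ i r, g i r ≠ 0 → r ∈ A i) ∧
      (∀ i, ∑ r, g i r = α i) ∧ (∀ j, #(U j) = β j) ∧
      ∀ r, ∑ i, g i r + #{j | r ∈ U j} ≤ cap r := by
  obtain ⟨g, x, y, hgA, hg, hxy, hy, hcap⟩ := exists_capacitated_flow cap A α β h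
  have hβ : ∀ j, β j ≤ #{r | 0 < x j r} := fun j => by
    have hβR : β j ≤ Fintype.card R := by simpa using h ∅ {j} ∅ (by simp)
    have htotal : ∑ r, x j r + ∑ r, y j r = Fintype.card R := by
      rw [← sum_add_distrib, sum_congr rfl fun r _ => hxy j r, sum_const, smul_eq_mul, mul_one,
        card_univ]
    have hx : ∑ r, x j r ≤ #{r | 0 < x j r} := by
      rw [card_filter]
      exact sum_le_sum fun r _ => by have := hxy j r; split_ifs <;> omega
    have := hy j
    omega
  choose U hU hUβ using fun j => exists_subset_card_eq (hβ j)
  refine ⟨g, U, hgA, hg, hUβ, fun r => (Nat.add_le_add_left ?_ _).trans (hcap r)⟩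
  rw [card_filter]
  refine sum_le_sum fun j _ => ?_
  split_ifs with hr
  · exact (mem_filter.1 (hU j hr)).2
  · exact Nat.zero_le _

/-- The Young diagram whose row lengths are the values of `p` in decreasing order: column `c`
consists of as many cells as there are indices `i` with `c < p i`. -/
def sortedDiagram {ι : Type*} [Fintype ι] (p : ι → ℕ) : YoungDiagram where
  cells := (range (Fintype.card ι) ×ˢ range (univ.sup p)).filter fun x => x.1 < #{i | x.2 < p i}
  isLowerSet := by
    rintro ⟨r, c⟩ ⟨r', c'⟩ ⟨hr, hc⟩ h
    simp only [mem_coe, mem_filter, mem_product, mem_range] at hr hc h ⊢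
    have hle : #{i | c < p i} ≤ #{i | c' < p i} :=
      card_le_card (monotone_filter_right _ fun i _ => hc.trans_lt)
    omega

section SortedDiagram
variable {ι : Type*} [Fintype ι] {p q : ι → ℕ}

theorem mem_sortedDiagram {r c : ℕ} : (r, c) ∈ sortedDiagram p ↔ r < #{i | c < p i} := by
  rw [← YoungDiagram.mem_cells, sortedDiagram, mem_filter, mem_product, mem_range, mem_range,
    and_iff_right_iff_imp]
  intro h
  obtain ⟨i, hi⟩ := card_pos.1 (Nat.zero_lt_of_lt h)
  exact ⟨h.trans_le (card_le_univ _), (mem_filter.1 hi).2.trans_le (le_sup (mem_univ i))⟩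

theorem sortedDiagram_mono (h : p ≤ q) : sortedDiagram p ≤ sortedDiagram q := by
  rintro ⟨r, c⟩ hx
  exact mem_sortedDiagram.2 ((mem_sortedDiagram.1 hx).trans_le
    (card_le_card (monotone_filter_right _ fun i _ hi => hi.trans_le (h i))))

theorem card_sortedDiagram (p : ι → ℕ) : (sortedDiagram p).card = ∑ i, p i := by
  have hcol : ∀ c, #{x ∈ (sortedDiagram p).cells | x.2 = c} = #{i | c < p i} := fun c => by
    rw [← card_range #{i | c < p i}, ← card_map (.sectL ℕ c)]
    congr 1
    ext ⟨r, c'⟩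
    simp only [mem_filter, YoungDiagram.mem_cells, mem_map, mem_range,
      Function.Embedding.sectL_apply, Prod.mk.injEq, mem_sortedDiagram]
    constructor
    · rintro ⟨h, rfl⟩
      exact ⟨r, h, rfl, rfl⟩
    · rintro ⟨_, h, rfl, rfl⟩
      exact ⟨h, rfl⟩
  have hrow : ∀ i, {c ∈ range (univ.sup p) | c < p i} = range (p i) := fun i => by
    ext c
    have : p i ≤ univ.sup p := le_sup (mem_univ i)
    simp only [mem_filter, mem_range]
    omega
  calc (sortedDiagram p).card = ∑ c ∈ range (univ.sup p), #{i | c < p i} := by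
        rw [YoungDiagram.card, card_eq_sum_card_fiberwise (s := (sortedDiagram p).cells)
          (f := Prod.snd) fun x hx => (mem_product.1 (mem_filter.1 hx).1).2]
        exact sum_congr rfl fun c _ => hcol c
    _ = ∑ i, #{c ∈ range (univ.sup p) | c < p i} :=
        sum_card_bipartiteAbove_eq_sum_card_bipartiteBelow _
    _ = ∑ i, p i := sum_congr rfl fun i _ => (congrArg card (hrow i)).trans (card_range _)

theorem sortedDiagram_rowLen (μ : YoungDiagram) :
    sortedDiagram (fun r : Fin (μ.colLen 0) => μ.rowLen r) = μ := by
  ext ⟨r, c⟩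
  have hcol : ∀ i, c < μ.rowLen i ↔ i < μ.colLen c := fun i =>
    YoungDiagram.mem_iff_lt_rowLen.symm.trans YoungDiagram.mem_iff_lt_colLen
  rw [YoungDiagram.mem_cells, YoungDiagram.mem_cells, mem_sortedDiagram,
    YoungDiagram.mem_iff_lt_colLen]
  simp only [hcol, Fin.card_filter_val_lt, min_eq_right (μ.colLen_anti 0 c c.zero_le)]

end SortedDiagram

theorem card_transpose (μ : YoungDiagram) : μ.transpose.card = μ.card :=
  card_equiv (Equiv.prodComm ℕ ℕ) fun _ => by simp

/-- The cells of `μ` in its first `i` rows or in its first `j` columns. Their number bounds the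
total multiplicity of any `i` letters `t` and `j` letters `u` in a semistandard tableau. -/
def hookCells (μ : YoungDiagram) (i j : ℕ) : Finset (ℕ × ℕ) :=
  {x ∈ μ.cells | x.1 < i ∨ x.2 < j}

theorem card_hookCells_transpose (μ : YoungDiagram) (i j : ℕ) :
    #(hookCells μ.transpose j i) = #(hookCells μ i j) := by
  refine card_equiv (Equiv.prodComm ℕ ℕ) fun x => ?_
  simp only [hookCells, mem_filter, YoungDiagram.mem_cells, YoungDiagram.mem_transpose,
    Equiv.prodComm_apply, Prod.fst_swap, Prod.snd_swap, or_comm]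

theorem card_hookCells_le (μ : YoungDiagram) {i : ℕ} (j : ℕ) {Q : Finset (Fin (μ.colLen 0))}
    (hQ : ∀ r : Fin (μ.colLen 0), (r : ℕ) < i → r ∈ Q) :
    #(hookCells μ i j) ≤ ∑ r ∈ Q, μ.rowLen r + #Qᶜ * j := by
  classical
  calc #(hookCells μ i j)
      ≤ #((Q.sigma fun r => range (μ.rowLen r)) ∪ Qᶜ.sigma fun _ => range j) := by
        refine card_le_card_of_surjOn (fun y => ((y.1 : ℕ), y.2)) ?_
        rintro ⟨r, c⟩ hx
        obtain ⟨hx, hrc⟩ := mem_filter.1 (mem_coe.1 hx)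
        have hr : r < μ.colLen 0 :=
          YoungDiagram.mem_iff_lt_colLen.1 (μ.up_left_mem le_rfl c.zero_le hx)
        have hc : c < μ.rowLen r := YoungDiagram.mem_iff_lt_rowLen.1 hx
        refine ⟨⟨⟨r, hr⟩, c⟩, ?_, rfl⟩
        by_cases hrQ : (⟨r, hr⟩ : Fin (μ.colLen 0)) ∈ Q
        · simp [hrQ, hc]
        · simpa [hrQ] using hrc.resolve_left fun hri => hrQ (hQ ⟨r, hr⟩ hri)
    _ ≤ _ := (card_union_le _ _).trans_eq (by simp)

theorem sum_le_card_hookCells_sortedDiagram {ι : Type*} [Fintype ι] (p : ι → ℕ) (P : Finset ι) :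
    ∑ i ∈ P, p i ≤ #(hookCells (sortedDiagram p) #P 0) := by
  have hle : ∀ c, #{i : P | c < p i} ≤ #{i | c < p i} := fun c =>
    card_le_card_of_injOn Subtype.val (fun i hi => by simpa using hi) Subtype.val_injective.injOn
  have hP : ∀ c, #{i : P | c < p i} ≤ #P := fun c => (card_le_univ _).trans_eq (by simp)
  rw [← sum_coe_sort P p, ← card_sortedDiagram fun i : P => p i]
  refine card_le_card fun ⟨r, c⟩ hx => ?_
  rw [YoungDiagram.mem_cells, mem_sortedDiagram] at hx
  exact mem_filter.2 ⟨mem_sortedDiagram.2 (hx.trans_le (hle c)), .inl (hx.trans_le (hP c))⟩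

/-- `μ / ν` is a vertical strip: it has at most one cell in each row. -/
def IsVerticalStrip (ν μ : YoungDiagram) : Prop :=
  ν ≤ μ ∧ ∀ r c, (r, c + 1) ∈ μ → (r, c) ∈ ν

/-- `μ / ν` is a horizontal strip: it has at most one cell in each column. -/
def IsHorizontalStrip (ν μ : YoungDiagram) : Prop :=
  ν ≤ μ ∧ ∀ r c, (r + 1, c) ∈ μ → (r, c) ∈ ν

theorem IsVerticalStrip.transpose {ν μ : YoungDiagram} (h : IsVerticalStrip ν μ) :
    IsHorizontalStrip ν.transpose μ.transpose :=
  ⟨YoungDiagram.transpose_mono h.1, fun r c hx =>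
    YoungDiagram.mem_transpose.2 (h.2 c r (YoungDiagram.mem_transpose.1 hx))⟩

theorem isVerticalStrip_sortedDiagram {ι : Type*} [Fintype ι] {p q : ι → ℕ} (hpq : p ≤ q)
    (hqp : ∀ i, q i ≤ p i + 1) : IsVerticalStrip (sortedDiagram p) (sortedDiagram q) := by
  refine ⟨sortedDiagram_mono hpq, fun r c hx => ?_⟩
  rw [mem_sortedDiagram] at hx ⊢
  exact hx.trans_le (card_le_card (monotone_filter_right _ fun i _ hi =>
    Nat.lt_of_succ_lt_succ (hi.trans_le (hqp i))))

theorem sum_card_filter_mem {R κ : Type*} [Fintype R] [DecidableEq R] (S : Finset κ)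
    (U : κ → Finset R) : ∑ r, #{j ∈ S | r ∈ U j} = ∑ j ∈ S, #(U j) := by
  have := sum_card_bipartiteAbove_eq_sum_card_bipartiteBelow (fun r j => r ∈ U j) (s := univ)
    (t := S)
  simpa [bipartiteAbove, bipartiteBelow] using this

theorem exists_verticalStrip_chain {R : Type*} [Fintype R] [DecidableEq R] {n : ℕ} (m : R → ℕ)
    (U : Fin n → Finset R) : ∃ H : ℕ → YoungDiagram,
      H 0 = sortedDiagram m ∧ H n = sortedDiagram (fun r => m r + #{j | r ∈ U j}) ∧
      (∀ s, IsVerticalStrip (H s) (H (s + 1))) ∧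
      ∀ j : Fin n, (H (j + 1)).card = (H j).card + #(U j) := by
  let before (s : ℕ) : Finset (Fin n) := {j | (j : ℕ) < s}
  have before_succ : ∀ j : Fin n, before (j + 1) = insert j (before j) := fun j => by
    ext i
    simp only [before, mem_filter, mem_univ, true_and, mem_insert, Fin.ext_iff]
    omega
  have hstep : ∀ s r, #{j ∈ before s | r ∈ U j} ≤ #{j ∈ before (s + 1) | r ∈ U j} ∧
      #{j ∈ before (s + 1) | r ∈ U j} ≤ #{j ∈ before s | r ∈ U j} + 1 := fun s r => by
    by_cases hs : s < n
    · rw [before_succ ⟨s, hs⟩, filter_insert]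
      split_ifs
      · exact ⟨card_le_card (subset_insert _ _), card_insert_le _ _⟩
      · exact ⟨le_rfl, Nat.le_succ _⟩
    · have : before (s + 1) = before s := filter_congr fun j _ => by omega
      exact this ▸ ⟨le_rfl, Nat.le_succ _⟩
  refine ⟨fun s => sortedDiagram fun r => m r + #{j ∈ before s | r ∈ U j}, ?_, ?_, fun s => ?_,
    fun j => ?_⟩
  · simp [before]
  · simp [before]
  · exact isVerticalStrip_sortedDiagram (fun r => Nat.add_le_add_left (hstep s r).1 _)
      fun r => Nat.add_le_add_left (hstep s r).2 _
  · have hj : j ∉ before j := by simp [before]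
    simp only [card_sortedDiagram, sum_add_distrib, sum_card_filter_mem, before_succ,
      sum_insert hj]
    omega

theorem exists_row_distribution_of_hook_inequalities {k ℓ : ℕ} {μ : YoungDiagram} (α : Fin k → ℕ)
    (β : Fin ℓ → ℕ) (htot : ∑ i, α i + ∑ j, β j = μ.card)
    (h : ∀ t ≤ k, ∀ J : Finset (Fin ℓ),
      ∑ i with i.1 < t, α i + ∑ j ∈ J, β j ≤ #(hookCells μ t #J)) :
    ∃ (g : Fin k → Fin (μ.colLen 0) → ℕ) (U : Fin ℓ → Finset (Fin (μ.colLen 0))),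
      (∀ i r, g i r ≠ 0 → (r : ℕ) ≤ i) ∧ (∀ i, ∑ r, g i r = α i) ∧ (∀ j, #(U j) = β j) ∧
      ∀ r, ∑ i, g i r + #{j | r ∈ U j} = μ.rowLen r := by
  obtain ⟨g, U, hg, hgα, hU, hle⟩ := exists_capacitated_assignment
    (fun r : Fin (μ.colLen 0) => μ.rowLen r) (fun i : Fin k => {r | (r : ℕ) ≤ i}) α β
    (fun I J Q hIQ => by
      obtain ⟨t, htk, hIt, htQ⟩ : ∃ t ≤ k, (∀ i ∈ I, (i : ℕ) < t) ∧
          ∀ r : Fin (μ.colLen 0), (r : ℕ) < t → r ∈ Q := by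
        rcases I.eq_empty_or_nonempty with rfl | hI
        · exact ⟨0, k.zero_le, by simp, by simp⟩
        · refine ⟨I.max' hI + 1, (I.max' hI).2, fun i hi => Nat.lt_succ_of_le (I.le_max' i hi),
            fun r hr => hIQ _ (I.max'_mem hI) ?_⟩
          simpa using Nat.le_of_lt_succ hr
      calc ∑ i ∈ I, α i + ∑ j ∈ J, β j ≤ ∑ i with i.1 < t, α i + ∑ j ∈ J, β j :=
            Nat.add_le_add_right (sum_le_sum_of_subset fun i hi => by simpa using hIt i hi) _
        _ ≤ #(hookCells μ t #J) := h t htk J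
        _ ≤ _ := mul_comm #J _ ▸ card_hookCells_le μ #J htQ)
  refine ⟨g, U, fun i r hr => by simpa using hg i r hr, hgα, hU, fun r =>
    (sum_eq_sum_iff_of_le fun r _ => hle r).1 ?_ r (mem_univ r)⟩
  rw [sum_add_distrib, sum_comm, sum_card_filter_mem, sum_congr rfl fun i _ => hgα i,
    sum_congr rfl fun j _ => hU j, htot, ← card_sortedDiagram, sortedDiagram_rowLen]

theorem exists_verticalStrip_chain_of_hook_inequalities {k ℓ : ℕ} {μ : YoungDiagram}
    (α : Fin k → ℕ) (β : Fin ℓ → ℕ) (htot : ∑ i, α i + ∑ j, β j = μ.card)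
    (h : ∀ t ≤ k, ∀ J : Finset (Fin ℓ),
      ∑ i with i.1 < t, α i + ∑ j ∈ J, β j ≤ #(hookCells μ t #J)) :
    ∃ H : ℕ → YoungDiagram, H ℓ = μ ∧ (∀ s, IsVerticalStrip (H s) (H (s + 1))) ∧
      (∀ j : Fin ℓ, (H (j + 1)).card = (H j).card + β j) ∧ (H 0).card = ∑ i, α i ∧
      ∀ t, ∑ i with i.1 < t, α i ≤ #(hookCells (H 0) t 0) := by
  obtain ⟨g, U, hg, hgα, hU, hrow⟩ := exists_row_distribution_of_hook_inequalities α β htot h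
  obtain ⟨H, hH0, hHℓ, hstrip, hcard⟩ := exists_verticalStrip_chain (fun r => ∑ i, g i r) U
  refine ⟨H, ?_, hstrip, fun j => hU j ▸ hcard j, ?_, fun t => ?_⟩
  · rw [hHℓ, funext hrow, sortedDiagram_rowLen]
  · rw [hH0, card_sortedDiagram, sum_comm]
    exact sum_congr rfl fun i _ => hgα i
  · set P : Finset (Fin (μ.colLen 0)) := {r | r.1 < t}
    have hP : #P ≤ t := (Fin.card_filter_val_lt).trans_le (min_le_right _ _)
    have hgP : ∀ i : Fin k, i.1 < t → α i = ∑ r ∈ P, g i r := fun i hi => by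
      rw [← hgα i]
      refine (sum_subset (subset_univ P) fun r _ hr => ?_).symm
      by_contra hgr
      exact hr (mem_filter.2 ⟨mem_univ r, (hg i r hgr).trans_lt hi⟩)
    calc ∑ i with i.1 < t, α i = ∑ i with i.1 < t, ∑ r ∈ P, g i r :=
          sum_congr rfl fun i hi => hgP i (mem_filter.1 hi).2
      _ ≤ ∑ i, ∑ r ∈ P, g i r := sum_le_sum_of_subset (filter_subset _ _)
      _ = ∑ r ∈ P, ∑ i, g i r := sum_comm
      _ ≤ #(hookCells (H 0) #P 0) := hH0 ▸ sum_le_card_hookCells_sortedDiagram _ P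
      _ ≤ #(hookCells (H 0) t 0) :=
          card_le_card (monotone_filter_right _ fun x _ hx => hx.imp_left hP.trans_lt')

theorem sum_le_sum_of_forall_notMem_le {ι : Type*} {f : ι → ℕ} {J P : Finset ι}
    (hJP : #J ≤ #P) (hf : ∀ i ∈ P, ∀ j ∉ P, f j ≤ f i) : ∑ i ∈ J, f i ≤ ∑ i ∈ P, f i := by
  classical
  have hcard : #(J \ P) ≤ #(P \ J) := card_sdiff_le_card_sdiff_iff.2 hJP
  refine sum_sdiff_le_sum_sdiff.1 ?_
  calc ∑ i ∈ J \ P, f i ≤ #(J \ P) • (J \ P).sup f :=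
        sum_le_card_nsmul _ _ _ fun i hi => le_sup hi
    _ ≤ #(P \ J) • (J \ P).sup f := Nat.mul_le_mul_right _ hcard
    _ ≤ ∑ i ∈ P \ J, f i := card_nsmul_le_sum _ _ _ fun i hi =>
        Finset.sup_le fun j hj => hf i (mem_sdiff.1 hi).1 j (mem_sdiff.1 hj).2

theorem sum_le_sum_filter_val_lt_card {k : ℕ} {α : Fin k → ℕ} {σ : Equiv.Perm (Fin k)}
    (hσ : Antitone (α ∘ σ)) (J : Finset (Fin k)) :
    ∑ i ∈ J, α i ≤ ∑ i with i.1 < #J, (α ∘ σ) i := by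
  have hJ : #(J.map σ.symm.toEmbedding) ≤ #{i : Fin k | i.1 < #J} := by
    rw [card_map, Fin.card_filter_val_lt, min_eq_right (card_finset_fin_le J)]
  calc ∑ i ∈ J, α i = ∑ i ∈ J.map σ.symm.toEmbedding, (α ∘ σ) i := by simp
    _ ≤ _ := sum_le_sum_of_forall_notMem_le hJ fun i hi j hj => hσ <| by
        simp only [mem_filter, mem_univ, true_and, not_lt] at hi hj
        exact Fin.le_def.2 (hi.le.trans hj)

theorem exists_fin_forall_iff_lt {P : ℕ → Prop} (hP : Monotone P) {n : ℕ} (h0 : ¬P 0) (hn : P n) :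
    ∃ i : Fin n, ∀ t, P t ↔ i < t := by
  classical
  have hex : ∃ t, P t := ⟨n, hn⟩
  obtain ⟨i, hi⟩ := Nat.exists_eq_succ_of_ne_zero ((Nat.find_pos hex).2 h0).ne'
  refine ⟨⟨i, Nat.lt_of_succ_le (hi ▸ Nat.find_le hn)⟩, fun t => ?_⟩
  rw [← Nat.succ_le_iff, ← hi]
  exact ⟨Nat.find_le, fun h => hP h (Nat.find_spec hex)⟩

/-- The filling `T` records the steps of two chains of Young diagrams: its letter `t_i` marks the
cells that `G` gains from stage `i` to stage `i + 1`, and its letter `u_j` those that `H` gains from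
stage `j` to stage `j + 1`. The chain `H` is meant to continue `G`. -/
structure IsChainFilling {k ℓ : ℕ} {μ : YoungDiagram} (G H : ℕ → YoungDiagram)
    (T : {c // c ∈ μ.cells} → Fin k ⊕ Fin ℓ) : Prop where
  mem_iff_of_eq_inl : ∀ {x i}, T x = .inl i → ∀ t, x.1 ∈ G t ↔ i < t
  mem_iff_of_eq_inr : ∀ {x j}, T x = .inr j → ∀ t, x.1 ∈ H t ↔ j < t

section ChainFilling
variable {k ℓ : ℕ} {μ : YoungDiagram} {G H : ℕ → YoungDiagram}

theorem exists_isChainFilling (hG : Monotone G) (hH : Monotone H) (hG0 : G 0 = ⊥)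
    (hGH : G k = H 0) (hHℓ : H ℓ = μ) :
    ∃ T : {c // c ∈ μ.cells} → Fin k ⊕ Fin ℓ, IsChainFilling G H T := by
  have hletter : ∀ x : {c // c ∈ μ.cells}, ∃ s : Fin k ⊕ Fin ℓ,
      (∀ i, s = .inl i → ∀ t, x.1 ∈ G t ↔ i < t) ∧ ∀ j, s = .inr j → ∀ t, x.1 ∈ H t ↔ j < t := by
    intro x
    by_cases hx : x.1 ∈ G k
    · obtain ⟨i, hi⟩ := exists_fin_forall_iff_lt (P := (x.1 ∈ G ·)) (fun _ _ h => @hG _ _ h x.1)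
        (fun h => YoungDiagram.notMem_bot x.1 (hG0.le h)) hx
      exact ⟨.inl i, fun _ h => Sum.inl_injective h ▸ hi, fun _ h => absurd h Sum.inl_ne_inr⟩
    · obtain ⟨j, hj⟩ := exists_fin_forall_iff_lt (P := (x.1 ∈ H ·)) (fun _ _ h => @hH _ _ h x.1)
        (fun h => hx (hGH.ge h)) (hHℓ.ge x.2)
      exact ⟨.inr j, fun _ h => absurd h Sum.inr_ne_inl, fun _ h => Sum.inr_injective h ▸ hj⟩
  choose T hT using hletter
  exact ⟨T, (hT _).1 _, (hT _).2 _⟩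

theorem letterCount_add_card {T : {c // c ∈ μ.cells} → Fin k ⊕ Fin ℓ} {s : Fin k ⊕ Fin ℓ}
    {ν ν' : YoungDiagram} (hνν' : ν ≤ ν') (hν'μ : ν' ≤ μ)
    (hT : ∀ x, T x = s ↔ x.1 ∈ ν' ∧ x.1 ∉ ν) : letterCount T s + ν.card = ν'.card := by
  have hcells : (univ.filter (T · = s)).map (.subtype _) = ν'.cells \ ν.cells := by
    ext x
    simp only [mem_map, mem_filter, mem_univ, true_and, hT, mem_sdiff, YoungDiagram.mem_cells]
    exact ⟨fun ⟨_, hx, h⟩ => h ▸ hx, fun hx => ⟨⟨x, hν'μ hx.1⟩, hx, rfl⟩⟩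
  rw [letterCount, ← card_map (.subtype _), hcells]
  exact card_sdiff_add_card_eq_card hνν'

namespace IsChainFilling
variable {T : {c // c ∈ μ.cells} → Fin k ⊕ Fin ℓ}

theorem toLex_le_toLex (hT : IsChainFilling G H T) (hGH : G k = H 0) {c d : {c // c ∈ μ.cells}}
    (hcd : c.1 ≤ d.1) : toLex (T c) ≤ toLex (T d) := by
  rcases hc : T c with i | j <;> rcases hd : T d with i' | j'
  · exact Sum.Lex.inl_le_inl_iff.2 (Nat.le_of_lt_succ ((hT.mem_iff_of_eq_inl hc _).1
      ((G _).isLowerSet hcd ((hT.mem_iff_of_eq_inl hd _).2 (Nat.lt_succ_self _)))))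
  · exact Sum.Lex.inl_le_inr _ _
  · have hd0 : d.1 ∈ H 0 := hGH ▸ (hT.mem_iff_of_eq_inl hd k).2 i'.2
    exact absurd ((hT.mem_iff_of_eq_inr hc 0).1 ((H 0).isLowerSet hcd hd0)) (Nat.not_lt_zero _)
  · exact Sum.Lex.inr_le_inr_iff.2 (Nat.le_of_lt_succ ((hT.mem_iff_of_eq_inr hc _).1
      ((H _).isLowerSet hcd ((hT.mem_iff_of_eq_inr hd _).2 (Nat.lt_succ_self _)))))

theorem isSuperSemistandard (hT : IsChainFilling G H T) (hGH : G k = H 0)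
    (hG : ∀ s, IsHorizontalStrip (G s) (G (s + 1))) (hH : ∀ s, IsVerticalStrip (H s) (H (s + 1))) :
    IsSuperSemistandard T where
  row_weak _ _ hrow hcol := hT.toLex_le_toLex hGH ⟨hrow.le, hcol.le⟩
  col_weak _ _ hcol hrow := hT.toLex_le_toLex hGH ⟨hrow.le, hcol.le⟩
  t_col_strict c d hcol hrow i i' hc hd := by
    have hd' : d.1 ∈ G (i' + 1) := (hT.mem_iff_of_eq_inl hd _).2 (Nat.lt_succ_self _)
    exact (hT.mem_iff_of_eq_inl hc _).1 <| (hG i').2 _ _ <|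
      (G (i' + 1)).up_left_mem (Nat.succ_le_of_lt hrow) hcol.le hd'
  u_row_strict c d hrow hcol j j' hc hd := by
    have hd' : d.1 ∈ H (j' + 1) := (hT.mem_iff_of_eq_inr hd _).2 (Nat.lt_succ_self _)
    exact (hT.mem_iff_of_eq_inr hc _).1 <| (hH j').2 _ _ <|
      (H (j' + 1)).up_left_mem hrow.le (Nat.succ_le_of_lt hcol) hd'

theorem letterCount_inl (hT : IsChainFilling G H T) (hG : Monotone G) (hH : Monotone H)
    (hGH : G k = H 0) (hHℓ : H ℓ = μ) (i : Fin k) :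
    letterCount T (.inl i) + (G i).card = (G (i + 1)).card := by
  have hle : G (i + 1) ≤ H 0 := hGH ▸ hG i.2
  refine letterCount_add_card (hG (Nat.le_succ _)) (hle.trans (hHℓ ▸ hH ℓ.zero_le)) fun x => ?_
  rcases hx : T x with i' | j
  · rw [hT.mem_iff_of_eq_inl hx, hT.mem_iff_of_eq_inl hx, Sum.inl.injEq, Fin.ext_iff]
    omega
  · have hx0 : x.1 ∉ H 0 := fun h => Nat.not_lt_zero _ ((hT.mem_iff_of_eq_inr hx 0).1 h)
    exact ⟨fun h => absurd h Sum.inr_ne_inl, fun h => absurd (hle h.1) hx0⟩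

theorem letterCount_inr (hT : IsChainFilling G H T) (hH : Monotone H)
    (hGH : G k = H 0) (hHℓ : H ℓ = μ) (j : Fin ℓ) :
    letterCount T (.inr j) + (H j).card = (H (j + 1)).card := by
  refine letterCount_add_card (hH (Nat.le_succ _)) (hHℓ ▸ hH j.2) fun x => ?_
  rcases hx : T x with i | j'
  · have hx0 : x.1 ∈ H 0 := hGH ▸ (hT.mem_iff_of_eq_inl hx k).2 i.2
    exact ⟨fun h => absurd h Sum.inl_ne_inr, fun h => absurd (hH (Nat.zero_le _) hx0) h.2⟩
  · rw [hT.mem_iff_of_eq_inr hx, hT.mem_iff_of_eq_inr hx, Sum.inr.injEq, Fin.ext_iff]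
    omega

end IsChainFilling

theorem exists_tableau_of_strip_chains (hG0 : G 0 = ⊥) (hGH : G k = H 0) (hHℓ : H ℓ = μ)
    (hG : ∀ s, IsHorizontalStrip (G s) (G (s + 1))) (hH : ∀ s, IsVerticalStrip (H s) (H (s + 1))) :
    ∃ T : {c // c ∈ μ.cells} → Fin k ⊕ Fin ℓ, IsSuperSemistandard T ∧
      (∀ i : Fin k, letterCount T (.inl i) + (G i).card = (G (i + 1)).card) ∧
      ∀ j : Fin ℓ, letterCount T (.inr j) + (H j).card = (H (j + 1)).card := by
  have hGmono : Monotone G := monotone_nat_of_le_succ fun s => (hG s).1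
  have hHmono : Monotone H := monotone_nat_of_le_succ fun s => (hH s).1
  obtain ⟨T, hT⟩ := exists_isChainFilling hGmono hHmono hG0 hGH hHℓ
  exact ⟨T, hT.isSuperSemistandard hGH hG hH, hT.letterCount_inl hGmono hHmono hGH hHℓ,
    hT.letterCount_inr hHmono hGH hHℓ⟩

end ChainFilling

theorem exists_tableau_of_hook_inequalities {k ℓ : ℕ} {μ : YoungDiagram} (α : Fin k → ℕ)
    (β : Fin ℓ → ℕ) (htot : ∑ i, α i + ∑ j, β j = μ.card)
    (h : ∀ (I : Finset (Fin k)) (J : Finset (Fin ℓ)),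
      ∑ i ∈ I, α i + ∑ j ∈ J, β j ≤ #(hookCells μ #I #J)) :
    ∃ T : {c // c ∈ μ.cells} → Fin k ⊕ Fin ℓ, IsSuperSemistandard T ∧
      (∀ i, letterCount T (.inl i) = α i) ∧ ∀ j, letterCount T (.inr j) = β j := by
  obtain ⟨σ, hσ⟩ : ∃ σ : Equiv.Perm (Fin k), Antitone (α ∘ σ) :=
    ⟨Tuple.sort (OrderDual.toDual ∘ α), Tuple.monotone_sort (OrderDual.toDual ∘ α)⟩
  have hinit : ∀ t ≤ k, ∀ J : Finset (Fin ℓ),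
      ∑ i with i.1 < t, (α ∘ σ) i + ∑ j ∈ J, β j ≤ #(hookCells μ t #J) := fun t ht J => by
    have := h (univ.filter (fun i : Fin k => i.1 < t) |>.map σ.toEmbedding) J
    rwa [sum_map, card_map, Fin.card_filter_val_lt, min_eq_right ht] at this
  obtain ⟨H, hHℓ, hH, hHβ, hHα, hH0⟩ := exists_verticalStrip_chain_of_hook_inequalities (α ∘ σ) β
    ((congrArg (· + _) (Equiv.sum_comp σ α)).trans htot) hinit
  have hα : ∑ i, α i = (H 0).transpose.card :=
    (Equiv.sum_comp σ α).symm.trans (hHα.symm.trans (card_transpose _).symm)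
  obtain ⟨G, hGk, hG, hGα, hG0, -⟩ := exists_verticalStrip_chain_of_hook_inequalities
    (μ := (H 0).transpose) Fin.elim0 α (by simpa using hα)
    (fun t ht J => by
      obtain rfl : t = 0 := Nat.le_zero.1 ht
      rw [card_hookCells_transpose]
      simpa using (sum_le_sum_filter_val_lt_card hσ J).trans (hH0 #J))
  have hG0' : (G 0).transpose = ⊥ :=
    YoungDiagram.ext (card_eq_zero.1 ((card_transpose _).trans hG0))
  obtain ⟨T, hT, hTG, hTH⟩ := exists_tableau_of_strip_chains (G := fun s => (G s).transpose) hG0'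
    (by rw [hGk, YoungDiagram.transpose_transpose]) hHℓ (fun s => (hG s).transpose) hH
  refine ⟨T, hT, fun i => ?_, fun j => ?_⟩
  · have := hTG i
    rw [card_transpose, card_transpose] at this
    have := hGα i
    omega
  · have := hTH j
    have := hHβ j
    omega

/-- The cells of `μ` that `T` fills with a letter of `S`, as a set of positions in the plane. -/
def letterCells {k ℓ : ℕ} {μ : YoungDiagram} (T : {c // c ∈ μ.cells} → Fin k ⊕ Fin ℓ)
    (S : Finset (Fin k ⊕ Fin ℓ)) : Finset (ℕ × ℕ) :=
  (univ.filter (T · ∈ S)).map (.subtype _)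

section LetterCells
variable {k ℓ : ℕ} {μ : YoungDiagram} {T : {c // c ∈ μ.cells} → Fin k ⊕ Fin ℓ}

theorem mem_letterCells {S : Finset (Fin k ⊕ Fin ℓ)} {x : ℕ × ℕ} :
    x ∈ letterCells T S ↔ ∃ hx : x ∈ μ.cells, T ⟨x, hx⟩ ∈ S := by
  simp [letterCells]

theorem letterCells_subset_cells (S : Finset (Fin k ⊕ Fin ℓ)) : letterCells T S ⊆ μ.cells :=
  fun _ hx => (mem_letterCells.1 hx).1

theorem letterCells_mono {S S' : Finset (Fin k ⊕ Fin ℓ)} (h : S ⊆ S') :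
    letterCells T S ⊆ letterCells T S' :=
  map_subset_map.2 (monotone_filter_right _ fun _ _ hx => h hx)

theorem disjoint_letterCells {S S' : Finset (Fin k ⊕ Fin ℓ)} (h : Disjoint S S') :
    Disjoint (letterCells T S) (letterCells T S') :=
  (disjoint_map _).2 (disjoint_filter.2 fun _ _ hx hx' => disjoint_left.1 h hx hx')

theorem sum_letterCount (S : Finset (Fin k ⊕ Fin ℓ)) :
    ∑ s ∈ S, letterCount T s = #(letterCells T S) := by
  rw [letterCells, card_map, card_eq_sum_card_fiberwise (f := T) (t := S) fun x hx => by
    simpa using hx]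
  refine sum_congr rfl fun s hs => congrArg card ?_
  rw [filter_filter]
  exact filter_congr fun x _ => ⟨fun h => ⟨h ▸ hs, h⟩, And.right⟩

namespace IsSuperSemistandard

theorem toLex_le_toLex (hT : IsSuperSemistandard T) {c d : {c // c ∈ μ.cells}}
    (hcd : c.1 ≤ d.1) : toLex (T c) ≤ toLex (T d) := by
  obtain ⟨⟨r, i⟩, hc⟩ := c
  obtain ⟨⟨r', i'⟩, hd⟩ := d
  obtain ⟨hr, hi⟩ : r ≤ r' ∧ i ≤ i' := hcd
  have he : (r, i') ∈ μ.cells := μ.up_left_mem hr le_rfl hd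
  have hrow : toLex (T ⟨(r, i), hc⟩) ≤ toLex (T ⟨(r, i'), he⟩) := by
    rcases hi.eq_or_lt with rfl | hi
    · rfl
    · exact hT.row_weak _ _ rfl hi
  have hcol : toLex (T ⟨(r, i'), he⟩) ≤ toLex (T ⟨(r', i'), hd⟩) := by
    rcases hr.eq_or_lt with rfl | hr
    · rfl
    · exact hT.col_weak _ _ rfl hr
  exact hrow.trans hcol

/-- The Young diagram formed by the cells that a semistandard tableau fills with letters `t`. -/
def tDiagram (hT : IsSuperSemistandard T) : YoungDiagram where
  cells := letterCells T (univ.map .inl)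
  isLowerSet d c hcd hd := by
    simp only [mem_coe, mem_letterCells, mem_map, mem_univ, true_and,
      Function.Embedding.inl_apply] at hd ⊢
    obtain ⟨hdμ, i, hi⟩ := hd
    have hcμ : c ∈ μ.cells := μ.isLowerSet hcd hdμ
    have hle := hT.toLex_le_toLex (c := ⟨c, hcμ⟩) (d := ⟨d, hdμ⟩) hcd
    rw [← hi] at hle
    rcases hc : T ⟨c, hcμ⟩ with i' | j
    · exact ⟨hcμ, i', hc.symm⟩
    · exact absurd (hc ▸ hle) Sum.Lex.not_inr_le_inl

theorem card_column_letterCells_inl_le (hT : IsSuperSemistandard T) (I : Finset (Fin k)) (c : ℕ) :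
    #{x ∈ letterCells T (I.map .inl) | x.2 = c} ≤ #I := by
  refine card_le_card_of_forall_subsingleton (fun x i => ∃ hx, T ⟨x, hx⟩ = .inl i)
    (fun x hx => ?_) fun i _ x hx y hy => ?_
  · obtain ⟨hxμ, hxI⟩ := mem_letterCells.1 (mem_filter.1 hx).1
    obtain ⟨i, hi, hix⟩ := mem_map.1 hxI
    exact ⟨i, hi, hxμ, hix.symm⟩
  · obtain ⟨hx, hxμ, hxi⟩ := hx
    obtain ⟨hy, hyμ, hyi⟩ := hy
    have hcol : x.2 = y.2 := (mem_filter.1 hx).2.trans (mem_filter.1 hy).2.symm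
    refine Prod.ext (by_contra fun hne => ?_) hcol
    rcases Nat.lt_or_gt_of_ne hne with hlt | hlt
    · exact (hT.t_col_strict ⟨x, hxμ⟩ ⟨y, hyμ⟩ hcol hlt i i hxi hyi).false
    · exact (hT.t_col_strict ⟨y, hyμ⟩ ⟨x, hxμ⟩ hcol.symm hlt i i hyi hxi).false

theorem card_row_letterCells_inr_le (hT : IsSuperSemistandard T) (J : Finset (Fin ℓ)) (r : ℕ) :
    #{x ∈ letterCells T (J.map .inr) | x.1 = r} ≤ #J := by
  refine card_le_card_of_forall_subsingleton (fun x j => ∃ hx, T ⟨x, hx⟩ = .inr j)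
    (fun x hx => ?_) fun j _ x hx y hy => ?_
  · obtain ⟨hxμ, hxJ⟩ := mem_letterCells.1 (mem_filter.1 hx).1
    obtain ⟨j, hj, hjx⟩ := mem_map.1 hxJ
    exact ⟨j, hj, hxμ, hjx.symm⟩
  · obtain ⟨hx, hxμ, hxj⟩ := hx
    obtain ⟨hy, hyμ, hyj⟩ := hy
    have hrow : x.1 = y.1 := (mem_filter.1 hx).2.trans (mem_filter.1 hy).2.symm
    refine Prod.ext hrow (by_contra fun hne => ?_)
    rcases Nat.lt_or_gt_of_ne hne with hlt | hlt
    · exact (hT.u_row_strict ⟨x, hxμ⟩ ⟨y, hyμ⟩ hrow hlt j j hxj hyj).false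
    · exact (hT.u_row_strict ⟨y, hyμ⟩ ⟨x, hxμ⟩ hrow.symm hlt j j hyj hxj).false

end IsSuperSemistandard

end LetterCells

theorem card_le_card_filter_of_card_row_le {μ : YoungDiagram} {X : Finset (ℕ × ℕ)}
    (hX : X ⊆ μ.cells) {b : ℕ} (hb : ∀ r, #{x ∈ X | x.1 = r} ≤ b) :
    #X ≤ #{x ∈ μ.cells | x.1 ∈ X.image Prod.fst ∧ x.2 < b} := by
  have hrow : ∀ r, #{x ∈ X | x.1 = r} ≤ #{x ∈ {x ∈ μ.cells | x.2 < b} | x.1 = r} := fun r => by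
    have hμ : #{x ∈ X | x.1 = r} ≤ μ.rowLen r :=
      (card_le_card (filter_subset_filter _ hX)).trans_eq μ.rowLen_eq_card.symm
    calc #{x ∈ X | x.1 = r} ≤ #((range (min b (μ.rowLen r))).map (.sectR r ℕ)) := by
          rw [card_map, card_range]
          exact le_min (hb r) hμ
      _ ≤ _ := card_le_card fun x hx => by
          obtain ⟨c, hc, rfl⟩ := mem_map.1 hx
          rw [mem_range, lt_min_iff] at hc
          exact mem_filter.2
            ⟨mem_filter.2 ⟨YoungDiagram.mem_iff_lt_rowLen.2 hc.2, hc.1⟩, rfl⟩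
  calc #X = ∑ r ∈ X.image Prod.fst, #{x ∈ X | x.1 = r} :=
        card_eq_sum_card_image Prod.fst X
    _ ≤ ∑ r ∈ X.image Prod.fst, #{x ∈ {x ∈ μ.cells | x.2 < b} | x.1 = r} :=
        sum_le_sum fun r _ => hrow r
    _ = _ := by
        rw [sum_card_fiberwise_eq_card_filter, filter_filter]
        simp only [and_comm]

theorem card_le_card_filter_of_card_column_le {μ : YoungDiagram} {X : Finset (ℕ × ℕ)}
    (hX : X ⊆ μ.cells) {a : ℕ} (ha : ∀ c, #{x ∈ X | x.2 = c} ≤ a) :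
    #X ≤ #{x ∈ μ.cells | x.1 < a} := by
  let swap : ℕ × ℕ ↪ ℕ × ℕ := (Equiv.prodComm ℕ ℕ).toEmbedding
  have hXt : X.map swap ⊆ μ.transpose.cells := fun x hx => by
    obtain ⟨y, hy, rfl⟩ := mem_map.1 hx
    simpa [swap] using hX hy
  have hrow : ∀ r, #{x ∈ X.map swap | x.1 = r} ≤ a := fun r => by
    rw [filter_map, card_map]
    exact ha r
  calc #X = #(X.map swap) := (card_map _).symm
    _ ≤ #{x ∈ μ.transpose.cells | x.2 < a} :=
        (card_le_card_filter_of_card_row_le hXt hrow).trans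
          (card_le_card (monotone_filter_right _ fun _ _ h => h.2))
    _ = #{x ∈ μ.cells | x.1 < a} := card_equiv (Equiv.prodComm ℕ ℕ) fun x => by simp

theorem card_hookCells_eq_of_le {ν μ : YoungDiagram} (h : ν ≤ μ) (a b : ℕ) :
    #(hookCells μ a b) = #{x ∈ ν.cells | x.1 < a} +
      (#{x ∈ μ.cells \ ν.cells | x.1 < a} + #{x ∈ μ.cells | a ≤ x.1 ∧ x.2 < b}) := by
  have hrows : #{x ∈ μ.cells | x.1 < a} =
      #{x ∈ ν.cells | x.1 < a} + #{x ∈ μ.cells \ ν.cells | x.1 < a} := by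
    rw [← card_union_of_disjoint (disjoint_filter_filter disjoint_sdiff), ← filter_union,
      union_sdiff_of_subset h]
  rw [← add_assoc, ← hrows, ← card_union_of_disjoint
    (disjoint_filter.2 fun x _ hx hx' => hx.not_ge hx'.1), ← filter_or]
  refine congrArg card (filter_congr fun x _ => ?_)
  omega

namespace IsSuperSemistandard
variable {k ℓ : ℕ} {μ : YoungDiagram} {T : {c // c ∈ μ.cells} → Fin k ⊕ Fin ℓ}

-- Pushing the `t`-letters up inside the diagram they form sends them to its first `#I` rows;
-- pushing the `u`-letters below row `#I` to the left sends them to the first `#J` columns.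
theorem sum_letterCount_le_card_hookCells (hT : IsSuperSemistandard T) (I : Finset (Fin k))
    (J : Finset (Fin ℓ)) :
    ∑ i ∈ I, letterCount T (.inl i) + ∑ j ∈ J, letterCount T (.inr j) ≤
      #(hookCells μ #I #J) := by
  set X := letterCells T (I.map .inl)
  set Y := letterCells T (J.map .inr)
  have hI : ∑ i ∈ I, letterCount T (.inl i) = #X := by rw [← sum_letterCount, sum_map]; rfl
  have hJ : ∑ j ∈ J, letterCount T (.inr j) = #Y := by rw [← sum_letterCount, sum_map]; rfl
  have hX : #X ≤ #{x ∈ hT.tDiagram.cells | x.1 < #I} :=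
    card_le_card_filter_of_card_column_le (letterCells_mono (map_subset_map.2 (subset_univ I)))
      (hT.card_column_letterCells_inl_le I)
  have hYtop : #{x ∈ Y | x.1 < #I} ≤ #{x ∈ μ.cells \ hT.tDiagram.cells | x.1 < #I} := by
    refine card_le_card (filter_subset_filter _ (subset_sdiff.2 ⟨letterCells_subset_cells _, ?_⟩))
    exact disjoint_letterCells (disjoint_map_inl_map_inr univ J).symm
  have hYbottom : #{x ∈ Y | #I ≤ x.1} ≤ #{x ∈ μ.cells | #I ≤ x.1 ∧ x.2 < #J} := by
    refine (card_le_card_filter_of_card_row_le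
      ((filter_subset _ _).trans (letterCells_subset_cells _)) fun r =>
        (card_le_card (filter_subset_filter _ (filter_subset _ Y))).trans
          (hT.card_row_letterCells_inr_le J r)).trans
      (card_le_card (monotone_filter_right _ fun x _ => And.imp_left fun hx => ?_))
    obtain ⟨y, hy, hyx⟩ := mem_image.1 hx
    exact hyx ▸ (mem_filter.1 hy).2
  have hY : #{x ∈ Y | x.1 < #I} + #{x ∈ Y | #I ≤ x.1} = #Y := by
    simpa only [not_lt] using card_filter_add_card_filter_not (s := Y) (·.1 < #I)
  rw [hI, hJ, ← hY, card_hookCells_eq_of_le (ν := hT.tDiagram) (letterCells_subset_cells _)]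
  exact add_le_add hX (add_le_add hYtop hYbottom)

end IsSuperSemistandard

theorem superSchur_eq_sum_monomial (k ℓ : ℕ) (μ : YoungDiagram) :
    superSchur k ℓ μ = ∑ T ∈ superSSYT k ℓ μ,
      MvPolynomial.monomial (Finsupp.equivFunOnFinite.symm (letterCount T)) 1 := by
  refine sum_congr rfl fun T _ => ?_
  rw [MvPolynomial.monomial_eq, map_one, one_mul, Finsupp.prod_fintype _ _ fun _ => pow_zero _,
    Fintype.prod_sum_type]
  rfl

theorem mem_realSupport_superSchur {k ℓ : ℕ} {μ : YoungDiagram} {p : Fin k ⊕ Fin ℓ → ℝ} :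
    p ∈ realSupport (superSchur k ℓ μ) ↔ ∃ T : {c // c ∈ μ.cells} → Fin k ⊕ Fin ℓ,
      IsSuperSemistandard T ∧ p = fun s => (letterCount T s : ℝ) := by
  classical
  have hcoeff : ∀ γ, MvPolynomial.coeff γ (superSchur k ℓ μ) ≠ 0 ↔
      ∃ T ∈ superSSYT k ℓ μ, Finsupp.equivFunOnFinite.symm (letterCount T) = γ := fun γ => by
    rw [superSchur_eq_sum_monomial, MvPolynomial.coeff_sum]
    simp only [MvPolynomial.coeff_monomial, sum_boole, Nat.cast_ne_zero, card_ne_zero,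
      Finset.Nonempty, mem_filter]
  constructor
  · rintro ⟨γ, hγ, rfl⟩
    obtain ⟨T, hT, rfl⟩ := (hcoeff γ).1 hγ
    exact ⟨T, (mem_filter.1 hT).2, rfl⟩
  · rintro ⟨T, hT, rfl⟩
    exact ⟨_, (hcoeff _).2 ⟨T, mem_filter.2 ⟨mem_univ _, hT⟩, rfl⟩, rfl⟩

/-- The polytope of weight vectors with coordinate sum `μ.card` that satisfy the hook inequalities:
any `i` letters `t` and `j` letters `u` have total weight at most the size of `hookCells μ i j`. -/
def hookPolytope (k ℓ : ℕ) (μ : YoungDiagram) : Set (Fin k ⊕ Fin ℓ → ℝ) :=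
  {p | (∀ s, 0 ≤ p s) ∧ ∑ s, p s = μ.card ∧ ∀ (I : Finset (Fin k)) (J : Finset (Fin ℓ)),
    ∑ i ∈ I, p (.inl i) + ∑ j ∈ J, p (.inr j) ≤ #(hookCells μ #I #J)}

theorem convex_hookPolytope (k ℓ : ℕ) (μ : YoungDiagram) : Convex ℝ (hookPolytope k ℓ μ) := by
  rintro p ⟨hp0, hp, hpIJ⟩ q ⟨hq0, hq, hqIJ⟩ a b ha hb hab
  refine ⟨fun s => add_nonneg (mul_nonneg ha (hp0 s)) (mul_nonneg hb (hq0 s)), ?_, fun I J => ?_⟩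
  · simp only [Pi.add_apply, Pi.smul_apply, smul_eq_mul, sum_add_distrib, ← mul_sum]
    rw [hp, hq, ← add_mul, hab, one_mul]
  · simp only [Pi.add_apply, Pi.smul_apply, smul_eq_mul, sum_add_distrib, ← mul_sum]
    calc a * ∑ i ∈ I, p (.inl i) + b * ∑ i ∈ I, q (.inl i) +
          (a * ∑ j ∈ J, p (.inr j) + b * ∑ j ∈ J, q (.inr j))
        = a * (∑ i ∈ I, p (.inl i) + ∑ j ∈ J, p (.inr j)) +
          b * (∑ i ∈ I, q (.inl i) + ∑ j ∈ J, q (.inr j)) := by ring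
      _ ≤ a * #(hookCells μ #I #J) + b * #(hookCells μ #I #J) :=
          add_le_add (mul_le_mul_of_nonneg_left (hpIJ I J) ha)
            (mul_le_mul_of_nonneg_left (hqIJ I J) hb)
      _ = #(hookCells μ #I #J) := by rw [← add_mul, hab, one_mul]

theorem realSupport_subset_latticePoints {σ R : Type*} [CommSemiring R] (f : MvPolynomial σ R) :
    realSupport f ⊆ latticePoints σ := by
  rintro _ ⟨γ, -, rfl⟩
  exact ⟨fun s => γ s, by simp only [Int.cast_natCast]⟩

theorem realSupport_superSchur (k ℓ : ℕ) (μ : YoungDiagram) :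
    realSupport (superSchur k ℓ μ) = hookPolytope k ℓ μ ∩ latticePoints (Fin k ⊕ Fin ℓ) := by
  refine (Set.subset_inter (fun p hp => ?_) (realSupport_subset_latticePoints _)).antisymm ?_
  · obtain ⟨T, hT, rfl⟩ := mem_realSupport_superSchur.1 hp
    refine ⟨fun s => Nat.cast_nonneg _, ?_, fun I J => ?_⟩
    · rw [← Nat.cast_sum, sum_letterCount]
      simp [letterCells]
    · beta_reduce
      exact_mod_cast hT.sum_letterCount_le_card_hookCells I J
  · rintro _ ⟨⟨h0, htot, hIJ⟩, z, rfl⟩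
    simp only [Int.cast_nonneg_iff] at h0
    lift z to Fin k ⊕ Fin ℓ → ℕ using h0
    simp only [Int.cast_natCast] at htot hIJ ⊢
    obtain ⟨T, hT, hα, hβ⟩ := exists_tableau_of_hook_inequalities (μ := μ)
      (fun i => z (.inl i)) (fun j => z (.inr j))
      (by rw [← Fintype.sum_sum_type]; exact_mod_cast htot) (by exact_mod_cast hIJ)
    refine mem_realSupport_superSchur.2 ⟨T, hT, funext ?_⟩
    rintro (i | j)
    · exact congrArg Nat.cast (hα i).symm
    · exact congrArg Nat.cast (hβ j).symm

theorem hasSaturatedNewtonPolytope_of_realSupport_eq {σ R : Type*} [CommSemiring R]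
    {f : MvPolynomial σ R} {P : Set (σ → ℝ)} (hP : Convex ℝ P)
    (h : realSupport f = P ∩ latticePoints σ) : HasSaturatedNewtonPolytope f := by
  have hfP : newtonPolytope f ⊆ P := convexHull_min (h ▸ Set.inter_subset_left) hP
  exact (h ▸ Set.inter_subset_inter_left _ hfP).antisymm
    (Set.subset_inter (subset_convexHull ℝ _) (realSupport_subset_latticePoints f))

end

theorem mainTheorem1 (k ℓ : ℕ) (hk : 1 ≤ k) (hℓ : 1 ≤ ℓ) (μ : YoungDiagram)
    (hμ : InHook k ℓ μ) : HasSaturatedNewtonPolytope (superSchur k ℓ μ) := by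
  exact hasSaturatedNewtonPolytope_of_realSupport_eq (convex_hookPolytope k ℓ μ)
    (realSupport_superSchur k ℓ μ)
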